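/- For integers $n_1,\dots,n_q\ge 0$ (with $q\ge 1$) let $R(n_1,\dots,n_q)$ be the smallest integer $n$ such that for every colouring of the edges of $K_n$ with colours $1,\dots,q$ there are a colour $i$ and a complete subgraph on $n_i$ vertices all of whose edges have colour $i$; write $R(n;q)=R(n,\dots,n)$ ($q$ entries). For integers $\omega\ge 1$ and $t,d\ge 0$ put $$r_{\omega+1}(t)=t+\binom t2(\omega^2+\omega-1),\qquad r_{i-1}(t)=R\bigl(t,R(r_i(t);\omega)\bigr)\quad(1\le i\le \omega+1),$$ $$c_{\omega+1}(t)=\sum_{j=0}^{\omega}\binom{r_j(t)}2,\qquad f_\omega(t,d)=\bigl(r_0(t)+2c_{\omega+1}(t)\bigr)\,2^{2(d+1)c_{\omega+1}(t)} .$$ Let $\Gamma$ be an abelian group, let $A\subseteq\Gamma$ be a non-empty set such that $\Gamma\setminus A$ is a subgroup of $\Gamma$ (necessarily proper; it may be $\{0\}$), let $G$ be a simple graph and let $\gamma:E(G)\to\Gamma$. The $\gamma$-value of a path or cycle is the sum of $\gamma(e)$ over its edges $e$. The $(\Gamma,A)$-vertex-arboricity $\operatorname{arb}_{(\Gamma,A)}(G,\gamma)$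 is the minimum integer $k$ such that $V(G)$ can be partitioned into $k$ parts, each inducing a subgraph that has no cycle of $\gamma$-value in $A$ ($\infty$ if there is no such $k$). Let $t,d\ge 0$ be integers. If $\operatorname{arb}_{(\Gamma,A)}(G,\gamma)\ge f_1(t,d)$, then $G$ contains a subdivision of $K_t$ in which every branching path (the path that replaces an edge of $K_t$) has $\gamma$-value in $A$ and length at least $d$. -/

import Mathlib

namespace GroupLabelled

universe u v

/-! ### Ramsey numbers and the bound -/

/-- The multicolour Ramsey number `R(n₁, …, n_q)`: the smallest `n` such that for every labelling
of the edges of `K_n` with `q` colours there are a colour `i` and a complete subgraph on `nᵢ`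
vertices all of whose edges have colour `i`. -/
noncomputable def ramseyNumber {q : ℕ} (ns : Fin q → ℕ) : ℕ :=
  sInf {n : ℕ | ∀ C : SimpleGraph.TopEdgeLabeling (Fin n) (Fin q),
    ∃ (i : Fin q) (s : Finset (Fin n)), (C.labelGraph i).IsNClique (ns i) s}

/-- The sequence `r_{ω+1}(t), r_ω(t), …, r_0(t)`, listed in this (decreasing) order of the index:
`r_{ω+1}(t) = t + (t choose 2) (ω² + ω - 1)` and `r_{i-1}(t) = R(t, R(r_i(t); ω))`, where `R(n; ω)`
is the Ramsey number `R(n, …, n)` with `ω` colours. -/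
noncomputable def rDown (ω t : ℕ) : ℕ → ℕ
  | 0 => t + t.choose 2 * (ω ^ 2 + ω - 1)
  | j + 1 => ramseyNumber ![t, ramseyNumber (fun _ : Fin ω => rDown ω t j)]

/-- The numbers `r_i(t)` for `0 ≤ i ≤ ω + 1`. -/
noncomputable def rSeq (ω t i : ℕ) : ℕ := rDown ω t (ω + 1 - i)

/-- The numbers `c_i(t) = ∑_{j=0}^{i-1} (r_j(t) choose 2)`. -/
noncomputable def cSeq (ω t i : ℕ) : ℕ := ∑ j ∈ Finset.range i, (rSeq ω t j).choose 2

/-- `f_ω(t, d) = (r_0(t) + 2 c_{ω+1}(t)) 2^{2 (d+1) c_{ω+1}(t)}`. -/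
noncomputable def fBound (ω t d : ℕ) : ℕ :=
  (rSeq ω t 0 + 2 * cSeq ω t (ω + 1)) * 2 ^ (2 * (d + 1) * cSeq ω t (ω + 1))

/-! ### Group-labelled graphs -/

variable {V : Type v} {Γ : Type u} [AddCommGroup Γ] {G : SimpleGraph V}

/-- The sum of the labels of the edges traversed by a walk. For paths and cycles, which traverse
each of their edges exactly once, this is the `γ`-value of the corresponding subgraph. -/
def value (γ : G.EdgeLabeling Γ) {a b : V} (p : G.Walk a b) : Γ :=
  (p.darts.map fun e => γ ⟨e.edge, e.edge_mem⟩).sum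

/-- The vertex set of `G` can be partitioned into `k` (possibly empty) parts, each of which induces
a subgraph that has no cycle of `γ`-value in `A`. The cycles of the subgraph induced by a part are
the cycles of `G` all of whose vertices lie in that part. -/
def Partitionable (γ : G.EdgeLabeling Γ) (A : Set Γ) (k : ℕ) : Prop :=
  ∃ part : V → Fin k, ∀ (i : Fin k) (a : V) (p : G.Walk a a),
    p.IsCycle → (∀ w ∈ p.support, part w = i) → value γ p ∉ A

/-- The `(Γ, A)`-vertex-arboricity of `(G, γ)`: the minimum `k` such that the vertex set can be
partitioned into `k` parts each inducing a subgraph without cycles of `γ`-value in `A`. It is `⊤`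
if there is no such `k`, which can only happen for infinite graphs. -/
noncomputable def arb (γ : G.EdgeLabeling Γ) (A : Set Γ) : ℕ∞ :=
  ⨅ k ∈ {k : ℕ | Partitionable γ A k}, (k : ℕ∞)

/-- A subdivision of `K_t` contained in `G`: distinct branching vertices, and for each pair of
branching vertices a branching path between them, such that no branching path has a branching
vertex in its interior and distinct branching paths are internally disjoint. -/
structure CompleteSubdivision (G : SimpleGraph V) (t : ℕ) where
  branch : Fin t ↪ V
  path : ∀ i j : Fin t, i < j → G.Walk (branch i) (branch j)
  isPath : ∀ i j (h : i < j), (path i j h).IsPath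
  branch_mem : ∀ i j (h : i < j) (k : Fin t),
    branch k ∈ (path i j h).support → k = i ∨ k = j
  disjoint : ∀ i j (h : i < j) (i' j' : Fin t) (h' : i' < j'), (i, j) ≠ (i', j') →
    ∀ w, w ∈ (path i j h).support → w ∈ (path i' j' h').support → w ∈ Set.range branch

/-- An `(A, d)`-subdivision of `K_t`: every branching path has `γ`-value in `A` and length at
least `d`. -/
def CompleteSubdivision.IsAD {t : ℕ} (H : CompleteSubdivision G t) (γ : G.EdgeLabeling Γ)
    (A : Set Γ) (d : ℕ) : Prop :=
  ∀ i j (h : i < j), value γ (H.path i j h) ∈ A ∧ d ≤ (H.path i j h).length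

end GroupLabelled

namespace GroupLabelled

open SimpleGraph

universe u v

/-! Let `Λ` be the complement of `A` and `m = t.choose 2`. Arboricity pays for everything a
subdivision needs. Some breadth-first layer keeps half of the arboricity, and the layers before it
form a connected set dominating it (`exists_layer`). Iterating `2 (d + 1) m` times gives a ladder of
disjoint connected rungs below a top set that is still not partitionable into `(t - 1) + 2 m` parts
(`exists_isLadder`). There, `m` disjoint cycles with value in `A` cost two parts each
(`exists_disjoint_isCycle`), and what remains has `t` vertices to branch at. Each pair of branching
vertices receives one cycle and `2 (d + 1)` rungs. Half of the rungs lead from one branching vertex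
to a point `a` of the cycle, the other half from a point `b` to the other one; crossing them makes
the path long. Suitable `a` and `b` are joined along the cycle by two paths that differ modulo `Λ`
(`exists_paths_of_isCycle`), so at least one choice gives a total outside `Λ`. Ramsey numbers enter
only in checking that `fBound 1 t d` is large enough (`le_fBound_one`). -/

/-! ### Ramsey numbers -/

/-- Finite Ramsey theorem for two colours. -/
theorem exists_ramsey (k l : ℕ) : ∃ N : ℕ, ∀ {α : Type} (H : SimpleGraph α) (s : Finset α),
    N ≤ s.card → (∃ a ⊆ s, H.IsNClique k a) ∨ (∃ b ⊆ s, Hᶜ.IsNClique l b) := by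
  classical
  induction k generalizing l with
  | zero => exact ⟨0, fun H s _ => Or.inl ⟨∅, by simp, by simp [isNClique_iff]⟩⟩
  | succ k ihk =>
    induction l with
    | zero => exact ⟨0, fun H s _ => Or.inr ⟨∅, by simp, by simp [isNClique_iff]⟩⟩
    | succ l ihl =>
      obtain ⟨N₁, h₁⟩ := ihk (l + 1)
      obtain ⟨N₂, h₂⟩ := ihl
      refine ⟨N₁ + N₂ + 1, fun {α} H s hs => ?_⟩
      obtain ⟨x, hx⟩ : s.Nonempty := Finset.card_pos.1 (by omega)
      have hcard := Finset.card_filter_add_card_filter_not (s := s.erase x) (fun y => H.Adj x y)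
      rw [Finset.card_erase_of_mem hx] at hcard
      by_cases hN : N₁ ≤ ((s.erase x).filter fun y => H.Adj x y).card
      · rcases h₁ H _ hN with ⟨a, ha, hc⟩ | ⟨b, hb, hc⟩
        · refine Or.inl ⟨insert x a, ?_, hc.insert fun y hy => (Finset.mem_filter.1 (ha hy)).2⟩
          exact Finset.insert_subset hx
            ((ha.trans (Finset.filter_subset _ _)).trans (Finset.erase_subset _ _))
        · exact Or.inr ⟨b, (hb.trans (Finset.filter_subset _ _)).trans (Finset.erase_subset _ _), hc⟩
      · rcases h₂ H ((s.erase x).filter fun y => ¬ H.Adj x y) (by omega) with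
          ⟨a, ha, hc⟩ | ⟨b, hb, hc⟩
        · exact Or.inl ⟨a, (ha.trans (Finset.filter_subset _ _)).trans (Finset.erase_subset _ _), hc⟩
        · refine Or.inr ⟨insert x b, ?_, hc.insert fun y hy => ?_⟩
          · exact Finset.insert_subset hx
              ((hb.trans (Finset.filter_subset _ _)).trans (Finset.erase_subset _ _))
          · have := Finset.mem_filter.1 (hb hy)
            exact (compl_adj _ _ _).2 ⟨(Finset.ne_of_mem_erase this.1).symm, this.2⟩

/-- As `sInf ∅ = 0` in `ℕ`, a lower bound needs the set to be non-empty, which is Ramsey's theorem.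
The bound itself only uses that a clique has at most `n` vertices. -/
theorem le_ramseyNumber_pair {m k l : ℕ} (hk : m ≤ k) (hl : m ≤ l) :
    m ≤ ramseyNumber ![k, l] := by
  obtain ⟨N, hN⟩ := exists_ramsey k l
  refine le_csInf ⟨N, fun C => ?_⟩ fun n hn => ?_
  · rcases hN (C.labelGraph 0) Finset.univ (by simp) with ⟨a, -, ha⟩ | ⟨b, -, hb⟩
    · exact ⟨0, a, ha⟩
    · refine ⟨1, b, hb.mono fun x y hxy => ?_⟩
      obtain ⟨hne, h⟩ := (compl_adj _ _ _).1 hxy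
      rw [EdgeLabeling.labelGraph_adj] at h ⊢
      have hxy' : (⊤ : SimpleGraph (Fin N)).Adj x y := hne
      refine ⟨hxy', ?_⟩
      have h0 : C ⟨s(x, y), hxy'⟩ ≠ 0 := fun h' => h ⟨hxy', h'⟩
      exact Fin.eq_one_of_ne_zero _ h0
  · obtain ⟨i, s, hs⟩ := hn fun _ => 0
    have := hs.card_eq ▸ s.card_le_univ
    fin_cases i <;> simp at this <;> omega

theorem le_ramseyNumber_single (m : ℕ) : m ≤ ramseyNumber (fun _ : Fin 1 => m) := by
  refine le_csInf ⟨m, fun C => ⟨0, Finset.univ, ?_⟩⟩ fun n hn => ?_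
  · rw [isNClique_iff]
    refine ⟨fun x _ y _ hxy => ?_, by simp⟩
    rw [EdgeLabeling.labelGraph_adj]
    exact ⟨hxy, Subsingleton.elim _ _⟩
  · obtain ⟨i, s, hs⟩ := hn fun _ => 0
    have := hs.card_eq ▸ s.card_le_univ
    simpa using this

theorem le_rDown_one (t j : ℕ) : t ≤ rDown 1 t j := by
  induction j with
  | zero => simp [rDown]
  | succ j ih =>
    rw [rDown]
    exact le_ramseyNumber_pair le_rfl (ih.trans (le_ramseyNumber_single _))

theorem le_fBound_one (t d : ℕ) :
    (t + 2 * t.choose 2) * 2 ^ (2 * (d + 1) * t.choose 2) ≤ fBound 1 t d := by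
  have hr : t ≤ rSeq 1 t 0 := le_rDown_one _ _
  have hc : t.choose 2 ≤ cSeq 1 t (1 + 1) := by
    -- The term `j = 0` alone suffices.
    rw [cSeq, Finset.sum_range_succ']
    exact le_add_left (Nat.choose_le_choose 2 hr)
  rw [fBound]
  gcongr
  norm_num

variable {V : Type v} {Γ : Type u} [AddCommGroup Γ] {G : SimpleGraph V}

/-! ### Walks and their values -/

theorem isPath_append {a b c : V} {p : G.Walk a b} {q : G.Walk b c} (hp : p.IsPath)
    (hq : q.IsPath) (h : ∀ w ∈ p.support, w ∈ q.support → w = b) : (p.append q).IsPath := by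
  induction p with
  | nil => exact hq
  | cons hadj p ih =>
    rw [Walk.cons_isPath_iff] at hp
    rw [Walk.cons_append, Walk.cons_isPath_iff]
    refine ⟨ih hp.1 hq fun w hw => h w (by simp [hw]), fun hmem => ?_⟩
    rcases (Walk.mem_support_append_iff _ _).1 hmem with h' | h'
    · exact hp.2 h'
    · exact hp.2 (h _ (by simp) h' ▸ p.end_mem_support)

/-- A function that agrees on adjacent vertices of `S` is constant along a walk in `S`. -/
theorem eq_of_mem_support {α : Type*} (f : V → α) (S : Set V)
    (hf : ∀ u ∈ S, ∀ v ∈ S, G.Adj u v → f u = f v) {a b : V} (p : G.Walk a b)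
    (hp : ∀ w ∈ p.support, w ∈ S) : ∀ w ∈ p.support, f w = f a := by
  induction p with
  | nil => simp
  | @cons x y z hadj p ih =>
    intro w hw
    rw [Walk.support_cons, List.mem_cons] at hw
    rcases hw with rfl | hw
    · rfl
    · rw [ih (fun w hw => hp w (by simp [hw])) w hw]
      exact (hf x (hp x (by simp)) y (hp y (by simp)) hadj).symm

theorem value_cons (γ : G.EdgeLabeling Γ) {a b c : V} (h : G.Adj a b) (p : G.Walk b c) :
    value γ (Walk.cons h p) = γ ⟨s(a, b), h⟩ + value γ p := rfl

theorem value_nil (γ : G.EdgeLabeling Γ) (a : V) : value γ (Walk.nil : G.Walk a a) = 0 := rfl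

theorem value_append (γ : G.EdgeLabeling Γ) {a b c : V} (p : G.Walk a b) (q : G.Walk b c) :
    value γ (p.append q) = value γ p + value γ q := by
  simp [value, Walk.darts_append]

theorem value_reverse (γ : G.EdgeLabeling Γ) {a b : V} (p : G.Walk a b) :
    value γ p.reverse = value γ p := by
  simp [value, Walk.darts_reverse, List.sum_reverse, Function.comp_def]

/-- A cycle with value outside a subgroup `Λ` contains two vertices joined along the cycle by two
paths whose values differ modulo `Λ`. -/
theorem exists_paths_of_isCycle (γ : G.EdgeLabeling Γ) (Λ : AddSubgroup Γ) {v : V}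
    (p : G.Walk v v) (hp : p.IsCycle) (hv : value γ p ∉ Λ) :
    ∃ (a b : V) (q₁ q₂ : G.Walk a b), a ≠ b ∧ q₁.IsPath ∧ q₂.IsPath ∧
      (∀ w ∈ q₁.support, w ∈ p.support) ∧ (∀ w ∈ q₂.support, w ∈ p.support) ∧
      value γ q₁ - value γ q₂ ∉ Λ := by
  match p, hp, hv with
  | .nil, hp, _ => exact absurd rfl hp.ne_nil
  | .cons h .nil, _, _ => exact absurd rfl h.ne
  | .cons (v := u) h (.cons (v := w) h' r), hp, hv =>
    have hpath := ((Walk.cons_isCycle_iff _ _).1 hp).1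
    have hlen := hp.three_le_length
    obtain ⟨hr, hur⟩ := (Walk.cons_isPath_iff _ _).1 hpath
    have hwv : w ≠ v := by
      rintro rfl
      have := Walk.length_eq_zero_iff.2 (Walk.isPath_iff_nil.1 hr)
      simp only [Walk.length_cons] at hlen
      omega
    simp only [value_cons] at hv
    -- One splitting may fail, since `x - y ∈ Λ` does not force `x + y ∈ Λ`. The vertices `v`, `u`,
    -- `w` cut the cycle into three arcs; if each arc agreed modulo `Λ` with the sum of the other
    -- two, adding the three relations would put minus the value of the cycle in `Λ`.
    by_cases h₁ : γ ⟨s(v, u), h⟩ - (γ ⟨s(u, w), h'⟩ + value γ r) ∈ Λ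
    swap
    · refine ⟨u, v, .cons h.symm .nil, .cons h' r, h.ne', ?_, hpath, ?_, ?_, ?_⟩
      · simp [h.ne']
      · simp
      · intro x hx
        rw [Walk.support_cons]
        exact List.mem_cons_of_mem _ hx
      · simpa [value_cons, value_nil, Sym2.eq_swap] using h₁
    by_cases h₂ : value γ r - (γ ⟨s(u, w), h'⟩ + γ ⟨s(v, u), h⟩) ∈ Λ
    swap
    · refine ⟨w, v, r, .cons h'.symm (.cons h.symm .nil), hwv, hr, ?_, ?_, ?_, ?_⟩
      · simp [h.ne', h'.ne', hwv]
      · intro x hx; simp [hx]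
      · simp
      · simpa [value_cons, value_nil, Sym2.eq_swap] using h₂
    by_cases h₃ : γ ⟨s(u, w), h'⟩ - (γ ⟨s(v, u), h⟩ + value γ r) ∈ Λ
    · refine absurd (Λ.neg_mem (Λ.add_mem (Λ.add_mem h₁ h₂) h₃)) ?_
      convert hv using 2
      abel
    · refine ⟨u, w, .cons h' .nil, .cons h.symm r.reverse, h'.ne, ?_, ?_, ?_, ?_, ?_⟩
      · simp [h'.ne]
      · simp [Walk.cons_isPath_iff, hr, hur]
      · simp
      · intro x hx
        simp only [Walk.support_cons, Walk.support_reverse, List.mem_cons, List.mem_reverse] at hx ⊢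
        exact Or.inr hx
      · simpa [value_cons, value_nil, Sym2.eq_swap, value_reverse] using h₃

/-! ### Partitions of vertex subsets -/

/-- The set `S` can be partitioned into `k` parts, each inducing a subgraph of `G` without cycles
of value in `A`. -/
def PartitionableOn (γ : G.EdgeLabeling Γ) (A : Set Γ) (S : Set V) (k : ℕ) : Prop :=
  ∃ part : V → ℕ, (∀ v ∈ S, part v < k) ∧ ∀ (i : ℕ) (a : V) (p : G.Walk a a),
    p.IsCycle → (∀ w ∈ p.support, w ∈ S ∧ part w = i) → value γ p ∉ A

variable {γ : G.EdgeLabeling Γ} {A : Set Γ}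

theorem PartitionableOn.partitionable {k : ℕ} (h : PartitionableOn γ A Set.univ k) :
    Partitionable γ A k := by
  obtain ⟨part, hlt, hc⟩ := h
  refine ⟨fun v => ⟨part v, hlt v trivial⟩, fun i a p hp hs => hc i a p hp fun w hw => ⟨trivial, ?_⟩⟩
  rw [← hs w hw]

theorem PartitionableOn.mono {S T : Set V} {k l : ℕ} (h : PartitionableOn γ A T k) (hST : S ⊆ T)
    (hkl : k ≤ l) : PartitionableOn γ A S l := by
  obtain ⟨part, hlt, hc⟩ := h
  exact ⟨part, fun v hv => (hlt v (hST hv)).trans_le hkl, fun i a p hp hs =>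
    hc i a p hp fun w hw => ⟨hST (hs w hw).1, (hs w hw).2⟩⟩

theorem PartitionableOn.union {S T : Set V} {k l : ℕ} (hS : PartitionableOn γ A S k)
    (hT : PartitionableOn γ A T l) : PartitionableOn γ A (S ∪ T) (k + l) := by
  classical
  obtain ⟨f, hf, hfc⟩ := hS
  obtain ⟨g, hg, hgc⟩ := hT
  refine ⟨fun v => if v ∈ S then f v else k + g v, fun v hv => ?_, fun i a p hp hs => ?_⟩
  · dsimp only
    split_ifs with h
    · exact (hf v h).trans_le (by omega)
    · have := hg v (hv.resolve_left h)
      omega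
  · by_cases hi : i < k
    · refine hfc i a p hp fun w hw => ?_
      obtain ⟨hw₁, hw₂⟩ := hs w hw
      dsimp only at hw₂
      split_ifs at hw₂ with h
      · exact ⟨h, hw₂⟩
      · omega
    · refine hgc (i - k) a p hp fun w hw => ?_
      obtain ⟨hw₁, hw₂⟩ := hs w hw
      dsimp only at hw₂
      split_ifs at hw₂ with h
      · have := hf w h
        omega
      · exact ⟨hw₁.resolve_left h, by omega⟩

theorem partitionableOn_empty : PartitionableOn γ A ∅ 0 :=
  ⟨fun _ => 0, by simp, fun _ a p _ h => absurd (h a p.start_mem_support).1 (by simp)⟩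

theorem partitionableOn_singleton (v : V) : PartitionableOn γ A {v} 1 := by
  refine ⟨fun _ => 0, by simp, fun i a p hp h => ?_⟩
  match p, hp, h with
  | .nil, hp, _ => exact absurd rfl hp.ne_nil
  | .cons (v := u) hadj r, _, h =>
    have h₁ := (h a (by simp)).1
    have h₂ := (h u (by simp)).1
    exact absurd (h₁.trans h₂.symm) hadj.ne

theorem partitionableOn_finset (s : Finset V) : PartitionableOn γ A (s : Set V) s.card := by
  classical
  induction s using Finset.induction_on with
  | empty => simpa using partitionableOn_empty
  | insert x s hx ih =>
    rw [Finset.card_insert_of_notMem hx, Finset.coe_insert, Set.insert_eq, Set.union_comm]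
    exact ih.union (partitionableOn_singleton x)

/-- A set that cannot be partitioned into `k` parts has more than `k` vertices. -/
theorem exists_finset_of_not_partitionableOn {T : Set V} {k : ℕ}
    (hT : ¬ PartitionableOn γ A T k) : ∃ s : Finset V, (s : Set V) ⊆ T ∧ s.card = k + 1 := by
  have h : (k + 1 : ℕ) ≤ T.encard := by
    by_contra! hlt
    have hfin : T.Finite := Set.finite_of_encard_le_coe hlt.le
    refine hT ?_
    have := partitionableOn_finset (γ := γ) (A := A) hfin.toFinset
    rw [hfin.coe_toFinset] at this
    refine this.mono le_rfl ?_
    rw [hfin.encard_eq_coe_toFinset_card] at hlt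
    have := Nat.cast_lt.1 hlt
    omega
  obtain ⟨s, hs, hc⟩ := Set.exists_subset_encard_eq h
  have hfin : s.Finite := Set.finite_of_encard_eq_coe hc
  refine ⟨hfin.toFinset, by simpa using hs, ?_⟩
  rw [hfin.encard_eq_coe_toFinset_card] at hc
  exact_mod_cast hc

/-- Deleting a shortest cycle with value in `A` decreases the arboricity by at most two. -/
theorem exists_isCycle_of_not_partitionableOn {T : Set V} {k : ℕ}
    (hT : ¬ PartitionableOn γ A T (k + 2)) :
    ∃ (a : V) (p : G.Walk a a), p.IsCycle ∧ value γ p ∈ A ∧ (∀ w ∈ p.support, w ∈ T) ∧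
      ¬ PartitionableOn γ A (T \ {w | w ∈ p.support}) k := by
  classical
  have hex : ∃ n : ℕ, ∃ (a : V) (p : G.Walk a a), p.IsCycle ∧ value γ p ∈ A ∧
      (∀ w ∈ p.support, w ∈ T) ∧ p.support.toFinset.card = n := by
    by_contra! hno
    refine hT ⟨fun _ => 0, by simp, fun i a p hp hs hA => ?_⟩
    exact hno _ a p hp hA (fun w hw => (hs w hw).1) rfl
  obtain ⟨a, p, hp, hA, hpT, hn⟩ := Nat.find_spec hex
  refine ⟨a, p, hp, hA, hpT, fun hpart => hT ?_⟩
  -- Separate `a` from the rest. A cycle inside one part misses `a` or `p.snd`, so it has fewer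
  -- vertices than `p`, and minimality applies.
  have h2 : PartitionableOn γ A {w | w ∈ p.support} 2 := by
    refine ⟨fun v => if v = a then 0 else 1, fun v _ => by dsimp only; split_ifs <;> simp,
      fun i b q hq hs hqA => ?_⟩
    have hlt : q.support.toFinset.card < p.support.toFinset.card := by
      refine Finset.card_lt_card ⟨fun w hw => ?_, fun hsub => ?_⟩
      · simpa using (hs w (by simpa using hw)).1
      · have ha := (hs a (by simpa using hsub (by simp))).2
        have hsnd : p.snd ∈ q.support := by
          simpa using hsub (by simp [Walk.getVert_mem_support])
        have := (hs _ hsnd).2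
        have hne : p.snd ≠ a := (p.adj_snd hp.not_nil).ne'
        simp only [if_true, hne, if_false] at ha this
        omega
    rw [hn] at hlt
    exact Nat.find_min hex hlt ⟨b, q, hq, hqA, fun w hw => hpT w (hs w hw).1, rfl⟩
  refine (hpart.union h2).mono (fun w hw => ?_) le_rfl
  by_cases h : w ∈ p.support
  · exact Or.inr h
  · exact Or.inl ⟨hw, h⟩

/-- A set of large arboricity contains many disjoint cycles with value in `A`. -/
theorem exists_disjoint_isCycle (m k : ℕ) {T : Set V}
    (hT : ¬ PartitionableOn γ A T (k + 2 * m)) :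
    ∃ C : ℕ → Set V, (∀ i < m, C i ⊆ T ∧ ∃ (a : V) (p : G.Walk a a), p.IsCycle ∧ value γ p ∈ A ∧
        ∀ w ∈ p.support, w ∈ C i) ∧
      (∀ i < m, ∀ j < m, i ≠ j → Disjoint (C i) (C j)) ∧
      ¬ PartitionableOn γ A {w ∈ T | ∀ i < m, w ∉ C i} k := by
  induction m generalizing k with
  | zero => exact ⟨fun _ => ∅, by simp, by simp, by simpa using hT⟩
  | succ m ih =>
    obtain ⟨C, hC, hdisj, hrest⟩ := ih (k + 2) (by rwa [show k + 2 + 2 * m = k + 2 * (m + 1) by ring])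
    obtain ⟨a, p, hp, hA, hpT, hpart⟩ := exists_isCycle_of_not_partitionableOn hrest
    have hdisj' : ∀ i < m, Disjoint (C i) {w | w ∈ p.support} := fun i hi =>
      Set.disjoint_left.2 fun w hw hw' => (hpT w hw').2 i hi hw
    refine ⟨Function.update C m {w | w ∈ p.support}, fun i hi => ?_, fun i hi j hj hij => ?_,
      fun h => hpart (h.mono ?_ le_rfl)⟩
    · rcases Nat.lt_succ_iff_lt_or_eq.1 hi with hi | rfl
      · rw [Function.update_of_ne hi.ne]
        exact hC i hi
      · rw [Function.update_self]
        exact ⟨fun w hw => (hpT w hw).1, a, p, hp, hA, fun w hw => hw⟩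
    · rcases Nat.lt_succ_iff_lt_or_eq.1 hi with hi | rfl <;>
        rcases Nat.lt_succ_iff_lt_or_eq.1 hj with hj | rfl
      · rw [Function.update_of_ne hi.ne, Function.update_of_ne hj.ne]
        exact hdisj i hi j hj hij
      · rw [Function.update_of_ne hi.ne, Function.update_self]
        exact hdisj' i hi
      · rw [Function.update_of_ne hj.ne, Function.update_self]
        exact (hdisj' j hj).symm
      · exact absurd rfl hij
    · rintro w ⟨⟨hwT, hw⟩, hwp⟩
      refine ⟨hwT, fun i hi => ?_⟩
      rcases Nat.lt_succ_iff_lt_or_eq.1 hi with hi | rfl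
      · rw [Function.update_of_ne hi.ne]
        exact hw i hi
      · rwa [Function.update_self]

/-! ### Breadth-first layers -/

/-- All fibres of `κ` share the same `k` colours, each refined by `par`: a monochromatic cycle has
constant `par`, hence stays in one fibre. -/
theorem PartitionableOn.of_layers {α : Type*} {S : Set V} {k : ℕ} (κ : V → α) (par : V → ℕ)
    (hpar : ∀ v, par v < 2)
    (hadj : ∀ u ∈ S, ∀ v ∈ S, G.Adj u v → par u = par v → κ u = κ v)
    (h : ∀ a, PartitionableOn γ A {v ∈ S | κ v = a} k) : PartitionableOn γ A S (2 * k) := by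
  choose f hf hfc using h
  refine ⟨fun v => 2 * f (κ v) v + par v, fun v hv => ?_, fun i a p hp hs => ?_⟩
  · have := hf (κ v) v ⟨hv, rfl⟩
    have := hpar v
    dsimp only
    omega
  · have hκ : ∀ w ∈ p.support, κ w = κ a := by
      refine eq_of_mem_support κ {w | w ∈ S ∧ par w = i % 2} ?_ p fun w hw => ⟨(hs w hw).1, ?_⟩
      · exact fun u hu v hv huv => hadj u hu.1 v hv.1 huv (hu.2.trans hv.2.symm)
      · have := (hs w hw).2
        have := hpar w
        dsimp only at *
        omega
    refine hfc (κ a) (i / 2) a p hp fun w hw => ⟨⟨(hs w hw).1, hκ w hw⟩, ?_⟩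
    have := (hs w hw).2
    have := hpar w
    rw [← hκ w hw]
    dsimp only at *
    omega

theorem exists_adj_dist_eq {H : SimpleGraph V} {r v : V} (hr : H.Reachable r v) {n : ℕ}
    (hn : H.dist r v = n + 1) : ∃ u, H.Adj u v ∧ H.dist r u = n := by
  obtain ⟨p, hp⟩ := hr.exists_walk_length_eq_dist
  have hnil : ¬ p.Nil := fun h => by
    have := Walk.length_eq_zero_iff.2 h
    omega
  have hadj := p.adj_penultimate hnil
  refine ⟨p.penultimate, hadj, le_antisymm ?_ ?_⟩
  · refine (dist_le p.dropLast).trans ?_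
    simp only [Walk.length_dropLast]
    omega
  · have hr' : H.Reachable r p.penultimate := ⟨p.dropLast⟩
    obtain ⟨q, hq⟩ := hr'.exists_walk_length_eq_dist
    have := dist_le (q.concat hadj)
    rw [Walk.length_concat] at this
    omega

/-- Any two vertices of `U` are joined by a walk in `U`. -/
def WalkConnected (G : SimpleGraph V) (U : Set V) : Prop :=
  ∀ a ∈ U, ∀ b ∈ U, ∃ p : G.Walk a b, ∀ w ∈ p.support, w ∈ U

/-- Some breadth-first layer has at least half of the arboricity; the earlier layers are connected
and dominate it. -/
theorem exists_layer {S : Set V} {k : ℕ} (hk : 1 ≤ k) (hS : ¬ PartitionableOn γ A S (2 * k)) :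
    ∃ L ⊆ S, ∃ U ⊆ S, Disjoint U L ∧ WalkConnected G U ∧ (∀ x ∈ L, ∃ y ∈ U, G.Adj x y) ∧
      ¬ PartitionableOn γ A L k := by
  classical
  let H : SimpleGraph V :=
    { Adj := fun a b => G.Adj a b ∧ a ∈ S ∧ b ∈ S
      symm := ⟨fun a b h => ⟨h.1.symm, h.2.2, h.2.1⟩⟩
      loopless := ⟨fun a h => h.1.ne rfl⟩ }
  let c : V → H.ConnectedComponent := H.connectedComponentMk
  let root : H.ConnectedComponent → V := fun K => K.out
  have hroot : ∀ K, c (root K) = K := fun K => K.out_eq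
  have hreach : ∀ v, H.Reachable (root (c v)) v := fun v =>
    ConnectedComponent.exact (hroot (c v))
  let ℓ : V → ℕ := fun v => H.dist (root (c v)) v
  have hc : ∀ {u v}, H.Adj u v → c u = c v := fun h =>
    ConnectedComponent.sound h.reachable
  have hℓ : ∀ {u v}, H.Adj u v → ℓ v ≤ ℓ u + 1 := by
    intro u v h
    obtain ⟨q, hq⟩ := (hreach u).exists_walk_length_eq_dist
    have := dist_le (q.concat h)
    rw [Walk.length_concat, hq, hc h] at this
    simpa only [ℓ, hc h] using this
  obtain ⟨⟨K, i⟩, hL⟩ : ∃ a : H.ConnectedComponent × ℕ,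
      ¬ PartitionableOn γ A {v ∈ S | (c v, ℓ v) = a} k := by
    by_contra! hall
    refine hS (.of_layers (fun v => (c v, ℓ v)) (fun v => ℓ v % 2) (fun v => Nat.mod_lt _ two_pos)
      (fun u hu v hv huv hpar => ?_) hall)
    have h : H.Adj u v := ⟨huv, hu, hv⟩
    have h₁ := hℓ h
    have h₂ := hℓ h.symm
    exact Prod.ext (hc h) (by dsimp only at *; omega)
  -- Layer zero is a single root, so `1 ≤ k` excludes it.
  have hi : i ≠ 0 := by
    rintro rfl
    refine hL ((partitionableOn_singleton (root K)).mono ?_ hk)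
    rintro v ⟨-, hv⟩
    obtain ⟨rfl, h0⟩ := Prod.mk.inj hv
    exact ((hreach v).dist_eq_zero_iff.1 h0).symm
  let U : Set V := {v ∈ S | c v = K ∧ ℓ v < i}
  have hdown : ∀ v n, c v = K → ℓ v = n + 1 → ∃ u, H.Adj u v ∧ c u = K ∧ ℓ u = n := by
    intro v n hv hn
    obtain ⟨u, hu, hun⟩ := exists_adj_dist_eq (hreach v) hn
    refine ⟨u, hu, (hc hu).trans hv, ?_⟩
    simpa only [ℓ, hc hu] using hun
  have hwalk : ∀ n v, v ∈ U → ℓ v = n → ∃ p : G.Walk (root K) v, ∀ w ∈ p.support, w ∈ U := by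
    intro n
    induction n with
    | zero =>
      intro v hv h0
      have hr : root K = v := by
        obtain ⟨-, rfl, -⟩ := hv
        exact (hreach v).dist_eq_zero_iff.1 h0
      subst hr
      exact ⟨.nil, by simpa using hv⟩
    | succ n ih =>
      intro v hv hn
      obtain ⟨u, hu, huK, hun⟩ := hdown v n hv.2.1 hn
      obtain ⟨p, hp⟩ := ih u ⟨hu.2.1, huK, by have := hv.2.2; omega⟩ hun
      refine ⟨p.concat hu.1, fun w hw => ?_⟩
      rw [Walk.support_concat, List.mem_append, List.mem_singleton] at hw
      rcases hw with hw | rfl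
      · exact hp w hw
      · exact hv
  refine ⟨_, Set.sep_subset _ _, U, Set.sep_subset _ _, ?_, ?_, ?_, hL⟩
  · refine Set.disjoint_left.2 fun v hv hv' => ?_
    have h1 := (Prod.mk.inj hv'.2).2
    have h2 := hv.2.2
    omega
  · intro a ha b hb
    obtain ⟨p, hp⟩ := hwalk _ a ha rfl
    obtain ⟨q, hq⟩ := hwalk _ b hb rfl
    refine ⟨p.reverse.append q, fun w hw => ?_⟩
    rw [Walk.mem_support_append_iff, Walk.support_reverse, List.mem_reverse] at hw
    exact hw.elim (hp w) (hq w)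
  · rintro x ⟨-, hx⟩
    obtain ⟨hxK, hxi⟩ := Prod.mk.inj hx
    obtain ⟨j, rfl⟩ := Nat.exists_eq_succ_of_ne_zero hi
    obtain ⟨u, hu, huK, hun⟩ := hdown x j hxK hxi
    exact ⟨u, ⟨hu.2.1, huK, by omega⟩, hu.1.symm⟩

/-- Nested sets `S 0 ⊇ S 1 ⊇ ⋯ ⊇ S n`, each dominated by a connected subset `U i` of the previous
one that avoids it. -/
structure IsLadder (G : SimpleGraph V) (S U : ℕ → Set V) (n : ℕ) : Prop where
  subset : ∀ i < n, S (i + 1) ⊆ S i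
  rung_subset : ∀ i < n, U i ⊆ S i
  disjoint : ∀ i < n, Disjoint (U i) (S (i + 1))
  connected : ∀ i < n, WalkConnected G (U i)
  dominates : ∀ i < n, ∀ x ∈ S (i + 1), ∃ y ∈ U i, G.Adj x y

theorem exists_isLadder {k : ℕ} (hk : 1 ≤ k) (n : ℕ)
    (h : ¬ PartitionableOn γ A Set.univ (k * 2 ^ n)) :
    ∃ S U : ℕ → Set V, IsLadder G S U n ∧ ¬ PartitionableOn γ A (S n) k := by
  classical
  induction n generalizing k with
  | zero =>
    exact ⟨fun _ => Set.univ, fun _ => ∅, ⟨by simp, by simp, by simp, by simp, by simp⟩,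
      by simpa using h⟩
  | succ n ih =>
    -- The last rung halves the arboricity once more, so the earlier ones are built with `2 * k`.
    obtain ⟨S, U, hSU, hn⟩ := ih (k := 2 * k) (by omega)
      (by rwa [show 2 * k * 2 ^ n = k * 2 ^ (n + 1) by ring])
    obtain ⟨L, hLS, W, hWS, hWL, hW, hdom, hL⟩ := exists_layer hk hn
    refine ⟨Function.update S (n + 1) L, Function.update U n W, ⟨?_, ?_, ?_, ?_, ?_⟩, by simpa⟩ <;>
    · intro i hi
      rcases Nat.lt_succ_iff_lt_or_eq.1 hi with hi | rfl
      · have h₁ : i ≠ n + 1 := by omega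
        have h₂ : i + 1 ≠ n + 1 := by omega
        have h₃ : i ≠ n := by omega
        simp only [Function.update_of_ne, ne_eq, h₁, h₂, h₃, not_false_eq_true]
        first
          | exact hSU.subset i hi
          | exact hSU.rung_subset i hi
          | exact hSU.disjoint i hi
          | exact hSU.connected i hi
          | exact hSU.dominates i hi
      · have h₁ : i ≠ i + 1 := by omega
        simp only [Function.update_self, Function.update_of_ne, ne_eq, h₁, not_false_eq_true]
        assumption

theorem IsLadder.antitone {S U : ℕ → Set V} {n : ℕ} (h : IsLadder G S U n) {i j : ℕ}
    (hij : i ≤ j) (hj : j ≤ n) : S j ⊆ S i := by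
  induction j, hij using Nat.le_induction with
  | base => exact subset_rfl
  | succ j hij ih => exact (h.subset j (by omega)).trans (ih (by omega))

theorem IsLadder.disjoint_of_lt {S U : ℕ → Set V} {n : ℕ} (h : IsLadder G S U n) {i j : ℕ}
    (hij : i < j) (hj : j ≤ n) : Disjoint (U i) (S j) :=
  (h.disjoint i (by omega)).mono_right (h.antitone hij hj)

theorem IsLadder.disjoint_rungs {S U : ℕ → Set V} {n : ℕ} (h : IsLadder G S U n) {i j : ℕ}
    (hi : i < n) (hj : j < n) (hij : i ≠ j) : Disjoint (U i) (U j) := by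
  rcases hij.lt_or_gt with hij | hij
  · exact (h.disjoint_of_lt hij hj.le).mono_right (h.rung_subset j hj)
  · exact ((h.disjoint_of_lt hij hi.le).mono_right (h.rung_subset i hi)).symm

/-- Two vertices above `d + 1` consecutive rungs of a ladder are joined through these rungs by a
path of length at least `d`. -/
theorem IsLadder.exists_path {S U : ℕ → Set V} {n : ℕ} (h : IsLadder G S U n) (l d : ℕ)
    (hd : l + d + 1 ≤ n) {x y : V} (hx : x ∈ S (l + d + 1)) (hy : y ∈ S (l + d + 1))
    (hxy : x ≠ y) :
    ∃ p : G.Walk x y, p.IsPath ∧ d ≤ p.length ∧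
      ∀ w ∈ p.support, w = x ∨ w = y ∨ ∃ i, l ≤ i ∧ i ≤ l + d ∧ w ∈ U i := by
  classical
  -- Only the `x` end descends rung by rung, gaining an edge each time; `y` lies in every earlier
  -- set, so it attaches directly to `U l`.
  induction d generalizing x with
  | zero =>
    obtain ⟨x', hx', hxx'⟩ := h.dominates l (by omega) x hx
    obtain ⟨y', hy', hyy'⟩ := h.dominates l (by omega) y hy
    obtain ⟨p, hp⟩ := h.connected l (by omega) x' hx' y' hy'
    refine ⟨(Walk.cons hxx' (p.concat hyy'.symm)).bypass, Walk.bypass_isPath _, Nat.zero_le _,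
      fun w hw => ?_⟩
    have := Walk.support_bypass_subset_support _ hw
    rw [Walk.support_cons, Walk.support_concat, List.mem_cons,
      List.mem_append, List.mem_singleton] at this
    rcases this with rfl | hw | rfl
    · exact Or.inl rfl
    · exact Or.inr (Or.inr ⟨l, le_rfl, le_rfl, hp w hw⟩)
    · exact Or.inr (Or.inl rfl)
  | succ d ih =>
    have hlt : l + d + 1 < n := by omega
    obtain ⟨x', hx', hxx'⟩ := h.dominates (l + d + 1) hlt x hx
    have hdisj := Set.disjoint_left.1 (h.disjoint (l + d + 1) hlt)
    obtain ⟨p, hp, hlen, hsupp⟩ := ih (x := x') hlt.le (h.rung_subset _ hlt hx')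
      (h.subset _ hlt hy) fun he => hdisj hx' (he ▸ hy)
    refine ⟨.cons hxx' p, (Walk.cons_isPath_iff _ _).2 ⟨hp, fun hmem => ?_⟩, by simpa,
      fun w hw => ?_⟩
    · rcases hsupp x hmem with rfl | rfl | ⟨i, hli, hil, hi⟩
      · exact hxx'.ne rfl
      · exact hxy rfl
      · exact Set.disjoint_left.1 (h.disjoint_of_lt (i := i) (j := l + (d + 1) + 1)
          (by omega) hd) hi hx
    · rw [Walk.support_cons, List.mem_cons] at hw
      rcases hw with rfl | hw
      · exact Or.inl rfl
      · rcases hsupp w hw with rfl | rfl | ⟨i, hli, hil, hi⟩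
        · exact Or.inr (Or.inr ⟨l + d + 1, by omega, by omega, hx'⟩)
        · exact Or.inr (Or.inl rfl)
        · exact Or.inr (Or.inr ⟨i, hli, by omega, hi⟩)

/-! ### Branching paths through cycles -/

/-- Two vertices at the top of a ladder are joined by a long path with value outside `Λ` that runs
through a prescribed cycle with value outside `Λ` and otherwise through `2 (d + 1)` rungs. -/
theorem IsLadder.exists_path_value_notMem {S U : ℕ → Set V} {n : ℕ} (h : IsLadder G S U n)
    (Λ : AddSubgroup Γ) (l d : ℕ) (hl : l + 2 * (d + 1) ≤ n) {x y : V} (hx : x ∈ S n)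
    (hy : y ∈ S n) (hxy : x ≠ y) {C : Set V} (hC : C ⊆ S n) (hxC : x ∉ C) (hyC : y ∉ C)
    {v : V} (c : G.Walk v v) (hc : c.IsCycle) (hval : value γ c ∉ Λ)
    (hsupp : ∀ w ∈ c.support, w ∈ C) :
    ∃ p : G.Walk x y, p.IsPath ∧ value γ p ∉ Λ ∧ d ≤ p.length ∧
      ∀ w ∈ p.support, w = x ∨ w = y ∨ w ∈ C ∨
        ∃ i, l ≤ i ∧ i < l + 2 * (d + 1) ∧ w ∈ U i := by
  obtain ⟨a, b, q₁, q₂, hab, hq₁, hq₂, hs₁, hs₂, hdiff⟩ := exists_paths_of_isCycle γ Λ c hc hval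
  have haC : a ∈ C := hsupp a (hs₁ a q₁.start_mem_support)
  have hbC : b ∈ C := hsupp b (hs₁ b q₁.end_mem_support)
  have htop : ∀ {j}, j ≤ n → S n ⊆ S j := fun hj => h.antitone hj le_rfl
  -- `p₁` uses the rungs `l, …, l + d` and `p₂` the next `d + 1`, so they meet only if their ends
  -- do. The length of `p₁` already suffices.
  obtain ⟨p₁, hp₁, hlen₁, hsp₁⟩ := h.exists_path l d (by omega) (htop (by omega) hx)
    (htop (by omega) (hC haC)) (fun he => hxC (he ▸ haC))
  obtain ⟨p₂, hp₂, -, hsp₂⟩ := h.exists_path (l + (d + 1)) d (by omega)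
    (htop (by omega) (hC hbC)) (htop (by omega) hy) (fun he => hyC (he ▸ hbC))
  have hU : ∀ {i}, i < n → ∀ {w}, w ∈ U i → w ∉ S n := fun hi w hw hw' =>
    Set.disjoint_left.1 (h.disjoint_of_lt hi le_rfl) hw hw'
  have key : ∀ q : G.Walk a b, q.IsPath → (∀ w ∈ q.support, w ∈ C) →
      value γ p₁ + (value γ q + value γ p₂) ∉ Λ →
      ∃ p : G.Walk x y, p.IsPath ∧ value γ p ∉ Λ ∧ d ≤ p.length ∧
        ∀ w ∈ p.support, w = x ∨ w = y ∨ w ∈ C ∨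
          ∃ i, l ≤ i ∧ i < l + 2 * (d + 1) ∧ w ∈ U i := by
    intro q hq hqC hqv
    refine ⟨p₁.append (q.append p₂), isPath_append hp₁ (isPath_append hq hp₂ ?_) ?_, ?_, ?_, ?_⟩
    · intro w hw hw'
      rcases hsp₂ w hw' with rfl | rfl | ⟨i, hi, hi', hwi⟩
      · rfl
      · exact absurd (hqC _ hw) hyC
      · exact absurd (hC (hqC _ hw)) (hU (by omega) hwi)
    · intro w hw hw'
      rw [Walk.mem_support_append_iff] at hw'
      rcases hsp₁ w hw with rfl | rfl | ⟨i, hi, hi', hwi⟩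
      · rcases hw' with hw' | hw'
        · exact absurd (hqC _ hw') hxC
        · rcases hsp₂ w hw' with rfl | rfl | ⟨j, hj, hj', hwj⟩
          · exact absurd hbC hxC
          · exact absurd rfl hxy
          · exact absurd hx (hU (by omega) hwj)
      · rfl
      · have hwS := hU (by omega) hwi
        rcases hw' with hw' | hw'
        · exact absurd (hC (hqC _ hw')) hwS
        · rcases hsp₂ w hw' with rfl | rfl | ⟨j, hj, hj', hwj⟩
          · exact absurd (hC hbC) hwS
          · exact absurd hy hwS
          · exact absurd hwj (Set.disjoint_left.1
              (h.disjoint_rungs (by omega) (by omega) (by omega : i ≠ j)) hwi)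
    · rwa [value_append, value_append]
    · rw [Walk.length_append]
      omega
    · intro w hw
      rw [Walk.mem_support_append_iff, Walk.mem_support_append_iff] at hw
      rcases hw with hw | hw | hw
      · rcases hsp₁ w hw with rfl | rfl | ⟨i, hi, hi', hwi⟩
        · exact Or.inl rfl
        · exact Or.inr (Or.inr (Or.inl haC))
        · exact Or.inr (Or.inr (Or.inr ⟨i, hi, by omega, hwi⟩))
      · exact Or.inr (Or.inr (Or.inl (hqC w hw)))
      · rcases hsp₂ w hw with rfl | rfl | ⟨i, hi, hi', hwi⟩
        · exact Or.inr (Or.inr (Or.inl hbC))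
        · exact Or.inr (Or.inl rfl)
        · exact Or.inr (Or.inr (Or.inr ⟨i, by omega, by omega, hwi⟩))
  -- The two totals differ by `value γ q₁ - value γ q₂ ∉ Λ`, so they are not both in `Λ`.
  by_cases hv : value γ p₁ + (value γ q₁ + value γ p₂) ∈ Λ
  · refine key q₂ hq₂ (fun w hw => hsupp w (hs₂ w hw)) fun hv' => hdiff ?_
    convert Λ.sub_mem hv hv' using 1
    abel
  · exact key q₁ hq₁ (fun w hw => hsupp w (hs₁ w hw)) hv

/-! ### The subdivision -/

/-- A subdivision whose branching paths run through disjoint regions `R e`, indexed by the pairs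
of branching vertices. -/
theorem exists_isAD_of_regions {t d : ℕ} (branch : Fin t ↪ V) (R : Fin t × Fin t → Set V)
    (hbranch : ∀ i j, i < j → ∀ k, branch k ∉ R (i, j))
    (hdisj : ∀ i j, i < j → ∀ i' j', i' < j' → (i, j) ≠ (i', j') →
      Disjoint (R (i, j)) (R (i', j')))
    (hpath : ∀ i j, i < j → ∃ p : G.Walk (branch i) (branch j), p.IsPath ∧ value γ p ∈ A ∧
      d ≤ p.length ∧ ∀ w ∈ p.support, w = branch i ∨ w = branch j ∨ w ∈ R (i, j)) :
    ∃ H : CompleteSubdivision G t, H.IsAD γ A d := by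
  choose p hp hv hd hs using hpath
  refine ⟨⟨branch, p, hp, fun i j h k hk => ?_, fun i j h i' j' h' hne w hw hw' => ?_⟩,
    fun i j h => ⟨hv i j h, hd i j h⟩⟩
  · rcases hs i j h _ hk with hk | hk | hk
    · exact Or.inl (branch.injective hk)
    · exact Or.inr (branch.injective hk)
    · exact absurd hk (hbranch i j h k)
  · rcases hs i j h w hw with rfl | rfl | hR
    · exact ⟨i, rfl⟩
    · exact ⟨j, rfl⟩
    rcases hs i' j' h' w hw' with rfl | rfl | hR'
    · exact ⟨i', rfl⟩
    · exact ⟨j', rfl⟩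
    · exact absurd hR' (Set.disjoint_left.1 (hdisj i j h i' j' h' hne) hR)

/-- The position of the pair `(i, j)`, `i < j`, in the colexicographic order. -/
def pairIndex {t : ℕ} (e : Fin t × Fin t) : ℕ := (e.2 : ℕ).choose 2 + e.1

/-- Pairs with larger entry `j` fill the block from `j.choose 2` up to, but excluding, `(j +
1).choose 2`; injectivity follows as these blocks are disjoint. -/
theorem pairIndex_lt_choose_succ {t : ℕ} {i j : Fin t} (h : i < j) :
    pairIndex (i, j) < ((j : ℕ) + 1).choose 2 := by
  have : (i : ℕ) < j := h
  rw [pairIndex, Nat.choose_succ_succ' _ 1, Nat.choose_one_right, add_comm]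
  exact Nat.add_lt_add_right this _

theorem pairIndex_lt {t : ℕ} {i j : Fin t} (h : i < j) : pairIndex (i, j) < t.choose 2 :=
  (pairIndex_lt_choose_succ h).trans_le (Nat.choose_le_choose 2 j.isLt)

theorem pairIndex_injOn {t : ℕ} {i j i' j' : Fin t} (h : i < j) (h' : i' < j')
    (he : pairIndex (i, j) = pairIndex (i', j')) : (i, j) = (i', j') := by
  have aux : ∀ {i j i' j' : Fin t}, i < j → j < j' → pairIndex (i, j) < pairIndex (i', j') := by
    intro i j i' j' h hj
    refine (pairIndex_lt_choose_succ h).trans_le ?_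
    have hj' : (j : ℕ) < j' := hj
    exact (Nat.choose_le_choose 2 hj').trans (Nat.le_add_right _ _)
  rcases lt_trichotomy j j' with hj | rfl | hj
  · exact absurd he (aux h hj).ne
  · have : (i : ℕ) = i' := by simpa [pairIndex] using he
    rw [Fin.ext this]
  · exact absurd he (aux h' hj).ne'

theorem exists_embedding_of_not_partitionableOn {T : Set V} {k : ℕ}
    (hT : ¬ PartitionableOn γ A T k) : ∃ f : Fin (k + 1) ↪ V, ∀ i, f i ∈ T := by
  obtain ⟨s, hs, hc⟩ := exists_finset_of_not_partitionableOn hT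
  exact ⟨(s.equivFinOfCardEq hc).symm.toEmbedding.trans (.subtype _), fun i => hs (by simp)⟩

/-- The factor is `s + 2 m`, not `s + 1 + 2 m`: failing to split into `s` parts already yields `s +
1` vertices. -/
theorem exists_isAD_of_not_partitionableOn (Λ : AddSubgroup Γ) (s d : ℕ)
    (h : ¬ PartitionableOn γ (Λ : Set Γ)ᶜ Set.univ
      ((s + 2 * (s + 1).choose 2) * 2 ^ (2 * (d + 1) * (s + 1).choose 2))) :
    ∃ H : CompleteSubdivision G (s + 1), H.IsAD γ (Λ : Set Γ)ᶜ d := by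
  -- For `s = 0` the factor vanishes and `exists_isLadder` does not apply, but one vertex is enough.
  rcases Nat.eq_zero_or_pos s with rfl | hs
  · obtain ⟨f, -⟩ := exists_embedding_of_not_partitionableOn (k := 0) (by simpa using h)
    exact exists_isAD_of_regions f (fun _ => ∅) (by simp) (by simp)
      fun i j hij => absurd hij (by omega)
  set m := (s + 1).choose 2
  obtain ⟨S, U, hSU, hT⟩ := exists_isLadder (by omega) _ h
  obtain ⟨C, hC, hCdisj, hrest⟩ := exists_disjoint_isCycle m s hT
  obtain ⟨f, hf⟩ := exists_embedding_of_not_partitionableOn hrest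
  have hrung : ∀ {e i : ℕ}, e < m → i / (2 * (d + 1)) = e → i < 2 * (d + 1) * m := by
    rintro e i he rfl
    rwa [Nat.div_lt_iff_lt_mul (by omega), mul_comm m] at he
  have htop : ∀ {e i : ℕ} {w : V}, e < m → i / (2 * (d + 1)) = e → w ∈ U i →
      w ∉ S (2 * (d + 1) * m) := fun he hi hw hw' =>
    Set.disjoint_left.1 (hSU.disjoint_of_lt (hrung he hi) le_rfl) hw hw'
  -- The pair of index `e` owns the cycle set `C e` and the block of `2 (d + 1)` rungs whose index
  -- has quotient `e`.
  refine exists_isAD_of_regions f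
    (fun e => {w | w ∈ C (pairIndex e) ∨ ∃ i, i / (2 * (d + 1)) = pairIndex e ∧ w ∈ U i})
    ?_ ?_ ?_
  · rintro i j hij k (hk | ⟨l, hl, hk⟩)
    · exact (hf k).2 _ (pairIndex_lt hij) hk
    · exact htop (pairIndex_lt hij) hl hk (hf k).1
  · intro i j hij i' j' hij' hne
    have he := pairIndex_lt hij
    have he' := pairIndex_lt hij'
    have hne' : pairIndex (i, j) ≠ pairIndex (i', j') := fun h => hne (pairIndex_injOn hij hij' h)
    refine Set.disjoint_left.2 ?_
    rintro w (hw | ⟨l, hl, hw⟩) (hw' | ⟨l', hl', hw'⟩)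
    · exact Set.disjoint_left.1 (hCdisj _ he _ he' hne') hw hw'
    · exact htop he' hl' hw' ((hC _ he).1 hw)
    · exact htop he hl hw ((hC _ he').1 hw')
    · exact Set.disjoint_left.1 (hSU.disjoint_rungs (hrung he hl) (hrung he' hl')
        (fun h => hne' (by rw [← hl, ← hl', h]))) hw hw'
  · intro i j hij
    have he := pairIndex_lt hij
    obtain ⟨hCS, a, c, hc, hcv, hcs⟩ := hC _ he
    obtain ⟨p, hp, hv, hd, hps⟩ := hSU.exists_path_value_notMem (γ := γ) Λ
      (2 * (d + 1) * pairIndex (i, j)) d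
      (by rw [← Nat.mul_succ]; exact Nat.mul_le_mul_left _ he) (hf i).1 (hf j).1
      (fun h => hij.ne (f.injective h)) hCS ((hf i).2 _ he) ((hf j).2 _ he) c hc hcv hcs
    refine ⟨p, hp, hv, hd, fun w hw => ?_⟩
    rcases hps w hw with h | h | h | ⟨l, hl, hl', h⟩
    · exact Or.inl h
    · exact Or.inr (Or.inl h)
    · exact Or.inr (Or.inr (Or.inl h))
    · refine Or.inr (Or.inr (Or.inr ⟨l, Nat.div_eq_of_lt_le ?_ ?_, h⟩))
      · rwa [mul_comm]
      · rwa [add_mul, one_mul, mul_comm (pairIndex _)]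

end GroupLabelled

theorem corollary6p2 {Γ : Type*} [AddCommGroup Γ] (A : Set Γ) (hA : A.Nonempty)
    (hsub : ∃ Λ : AddSubgroup Γ, (Λ : Set Γ) = Aᶜ)
    {V : Type*} (G : SimpleGraph V) (γ : G.EdgeLabeling Γ) (t d : ℕ)
    (harb : (GroupLabelled.fBound 1 t d : ℕ∞) ≤ GroupLabelled.arb γ A) :
    ∃ H : GroupLabelled.CompleteSubdivision G t, H.IsAD γ A d := by
  obtain ⟨Λ, hΛ⟩ := hsub
  obtain rfl : (Λ : Set Γ)ᶜ = A := by rw [hΛ, compl_compl]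
  obtain _ | s := t
  · exact GroupLabelled.exists_isAD_of_regions ⟨Fin.elim0, fun i => i.elim0⟩ (fun _ => ∅)
      (fun i => i.elim0) (fun i => i.elim0) (fun i => i.elim0)
  refine GroupLabelled.exists_isAD_of_not_partitionableOn Λ s d fun h => ?_
  have hle := harb.trans (iInf₂_le _ h.partitionable)
  have hf := (GroupLabelled.le_fBound_one (s + 1) d).trans (Nat.cast_le.1 hle)
  -- Strict because `s` replaces `t = s + 1` in the first factor.
  refine absurd hf (not_le.2 (Nat.mul_lt_mul_of_pos_right (by omega) (by positivity)))
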